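/- Graphs are finite and simple. For a graph $H$ and a family $\mathcal F$ of graphs, let $\mathcal N(H,G)$ be the number of copies of $H$ in $G$ (subgraphs of $G$ isomorphic to $H$), call $G$ $\mathcal F$-free if it contains no member of $\mathcal F$ as a (not necessarily induced) subgraph, and let $\mathrm{ex}(n,H,\mathcal F)$ be the maximum of $\mathcal N(H,G)$ over all $n$-vertex $\mathcal F$-free graphs $G$; let $\mathrm{EX}(n,H,\mathcal F)$ be the set of $n$-vertex $\mathcal F$-free graphs $G$ with $\mathcal N(H,G)=\mathrm{ex}(n,H,\mathcal F)$. Let $K_r$ be the complete graph on $r$ vertices, $M_{s+1}$ the matching of $s+1$ independent edges, $I_m$ the edgeless graph on $m$ vertices, and $G\vee H$ the join of $G$ and $H$. For a graph $F$, let $\mathcal D(F)$ be the set of all graphs obtained from $F$ by deleting a (possibly empty) independent set of vertices, and let $D_F(s,r)$ denote any graph in $\mathrm{EX}(s,K_{r-1},\mathcal D(F))$ with the maximum number of copies of $K_r$ among the graphs in $\mathrm{EX}(s,K_{r-1},\mathcal D(F))$. **Theorem.** Let $r\ge 3$ be an integer and let $F$ be a graph with $\chi(F)>r$. There is $s_0=s_0(F,r)$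 such that for every $s\ge s_0$ a graph $D_F(s,r)$ exists and there is $n_0=n_0(F,r,s)\ge s$ such that for all $n\ge n_0$ and every choice of $D_F(s,r)$, $$\mathrm{ex}(n,K_r,\{F,M_{s+1}\})=\mathcal N\bigl(K_r,\,D_F(s,r)\vee I_{n-s}\bigr).$$ -/

import Mathlib

namespace GenTuran

/-- A finite graph, on a vertex set `Fin m`. -/
abbrev FinGraph : Type := Σ m : ℕ, SimpleGraph (Fin m)

/-- All the finite graphs (on vertex sets `Fin m`) that are isomorphic to `G`. A family of finite
graphs is represented by the set of all graphs on vertex sets `Fin m` isomorphic to a member. -/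
def isoClass {V : Type*} (G : SimpleGraph V) : Set FinGraph :=
  {A | Nonempty (A.2 ≃g G)}

/-- `G` is `𝓕`-free: it contains no member of `𝓕` as a (not necessarily induced) subgraph. -/
def FamilyFree {V : Type*} (𝓕 : Set FinGraph) (G : SimpleGraph V) : Prop :=
  ∀ A ∈ 𝓕, A.2.Free G

/-- The generalized Turán number `ex(n, H, 𝓕)`: the maximum number of copies of `H` in an
`𝓕`-free graph on `n` vertices. -/
noncomputable def ex {W : Type*} (n : ℕ) (H : SimpleGraph W) (𝓕 : Set FinGraph) : ℕ :=
  sSup {k : ℕ | ∃ G : SimpleGraph (Fin n), FamilyFree 𝓕 G ∧ k = G.copyCount H}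

/-- `EX(n, H, 𝓕)`: the `𝓕`-free graphs on `n` vertices with exactly `ex(n, H, 𝓕)` copies
of `H`. -/
def EX {W : Type*} (n : ℕ) (H : SimpleGraph W) (𝓕 : Set FinGraph) : Set (SimpleGraph (Fin n)) :=
  {G | FamilyFree 𝓕 G ∧ G.copyCount H = ex n H 𝓕}

/-- The complete graph `K_r` on `r` vertices. -/
def K (r : ℕ) : SimpleGraph (Fin r) := ⊤

/-- The independent set `I_m`: the graph on `m` vertices without edges. -/
def I (m : ℕ) : SimpleGraph (Fin m) := ⊥

/-- The matching `M_m`: `m` pairwise disjoint edges `{(i, false), (i, true)}`. -/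
def M (m : ℕ) : SimpleGraph (Fin m × Bool) where
  Adj x y := x.1 = y.1 ∧ x.2 ≠ y.2
  symm := ⟨fun _ _ h => ⟨h.1.symm, h.2.symm⟩⟩
  loopless := ⟨fun _ h => h.2 rfl⟩

/-- The join `G ∨ H`: the disjoint union of `G` and `H` together with all edges between them. -/
def join {V W : Type*} (G : SimpleGraph V) (H : SimpleGraph W) : SimpleGraph (V ⊕ W) where
  Adj x y :=
    match x, y with
    | Sum.inl v, Sum.inl v' => G.Adj v v'
    | Sum.inr w, Sum.inr w' => H.Adj w w'
    | Sum.inl _, Sum.inr _ => True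
    | Sum.inr _, Sum.inl _ => True
  symm := ⟨by
    rintro (v | w) (v' | w') h
    · exact G.adj_symm h
    · trivial
    · trivial
    · exact H.adj_symm h⟩
  loopless := ⟨by
    rintro (v | w) h
    · exact G.irrefl h
    · exact H.irrefl h⟩

/-- The family `𝓓(F)` of all graphs obtained from `F` by deleting an independent set of `F`. -/
def deletionFamily {V : Type*} (F : SimpleGraph V) : Set FinGraph :=
  {A | ∃ S : Set V, F.IsIndepSet S ∧ A ∈ isoClass (F.induce Sᶜ)}

/-- The family `{F, M_{s+1}}`. -/
def forbiddenPair {V : Type*} (F : SimpleGraph V) (s : ℕ) : Set FinGraph :=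
  isoClass F ∪ isoClass (M (s + 1))

/-- `D` is a choice of the graph `D_F(s, r)`: a member of `EX(s, K_{r-1}, 𝓓(F))` with the maximum
number of copies of `K_r` among the members of `EX(s, K_{r-1}, 𝓓(F))`. -/
def IsDF {V : Type*} (F : SimpleGraph V) (s r : ℕ) (D : SimpleGraph (Fin s)) : Prop :=
  D ∈ EX s (K (r - 1)) (deletionFamily F) ∧
    ∀ D' ∈ EX s (K (r - 1)) (deletionFamily F), D'.copyCount (K r) ≤ D.copyCount (K r)

end GenTuran

/-!
For the lower bound, deleting from a copy of `F` in `D ∨ I_{n-s}` its vertices in `I_{n-s}` leaves a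
member of `𝓓(F)` in `D`, and the `s` vertices of `D` cover all the edges, so the join is free.

For the upper bound, let `G` be `{F, M_{s+1}}`-free and let `A` be its set of high-degree vertices.
Greedy matching gives `|A| ≤ s`, and all but boundedly many vertices have a neighbourhood that is
contained in `A` and induces a `𝓓(F)`-free graph. The sequence `m ↦ ex(m, K_{r-1}, 𝓓(F))` eventually
exceeds all its earlier values: by the Turán graph it has order `m^{r-1}`, so in an extremal graph
some `K_{r-2}` has many common neighbours, and a new vertex joined to this `K_{r-2}` adds a
`K_{r-1}` but no new member of `𝓓(F)`. Hence either almost every vertex lies in fewer than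
`ex(s, K_{r-1}, 𝓓(F))` copies of `K_r`, which is too few when `n` is large, or some neighbourhood is
all of `A`, `|A| = s` and `G[A]` is in `EX(s, K_{r-1}, 𝓓(F))`. In that case `A` covers all the
edges, and the copies of `K_r` are counted inside `A` and through the vertices outside `A`.
-/

namespace GenTuran

open Finset

section Cliques

variable {V W : Type*}

lemma nonempty_K_iso_iff [Finite W] {H : SimpleGraph W} {k : ℕ} :
    Nonempty (K k ≃g H) ↔ H = ⊤ ∧ Nat.card W = k := by
  constructor
  · rintro ⟨e⟩
    refine ⟨SimpleGraph.ext ?_, by simpa using (Nat.card_congr e.toEquiv).symm⟩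
    ext x y
    rw [← e.symm.map_adj_iff]
    exact e.symm.injective.ne_iff
  · rintro ⟨rfl, rfl⟩
    exact ⟨SimpleGraph.Iso.completeGraph (Finite.equivFin W).symm⟩

lemma coe_eq_top_iff {G : SimpleGraph V} {G' : G.Subgraph} :
    G'.coe = ⊤ ↔ G.IsClique G'.verts ∧ G' = (⊤ : G.Subgraph).induce G'.verts := by
  constructor
  · intro h
    have hadj {x y : V} (hx : x ∈ G'.verts) (hy : y ∈ G'.verts) (hxy : x ≠ y) : G'.Adj x y := by
      have : G'.coe.Adj ⟨x, hx⟩ ⟨y, hy⟩ := by simp [h, hxy]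
      exact this
    refine ⟨fun x hx y hy hxy => (hadj hx hy hxy).adj_sub, SimpleGraph.Subgraph.ext rfl ?_⟩
    ext x y
    exact ⟨fun h => ⟨h.fst_mem, h.snd_mem, h.adj_sub⟩, fun h => hadj h.1 h.2.1 h.2.2.ne⟩
  · rintro ⟨hclique, hind⟩
    rw [hind]
    ext x y
    exact ⟨fun h hxy => h.2.2.ne (congrArg Subtype.val hxy),
      fun h => ⟨x.2, y.2, hclique x.2 y.2 (Subtype.coe_ne_coe.2 h)⟩⟩

lemma copyCount_K [Fintype V] (G : SimpleGraph V) (k : ℕ) :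
    G.copyCount (K k) = (G.cliqueSet k).ncard := by
  classical
  have himage : {G' : G.Subgraph | Nonempty (K k ≃g G'.coe)} =
      (fun t : Finset V => (⊤ : G.Subgraph).induce t) '' G.cliqueSet k := by
    ext G'
    simp only [Set.mem_ofPred_eq, nonempty_K_iso_iff, coe_eq_top_iff, Set.mem_image]
    constructor
    · rintro ⟨⟨hclique, hind⟩, hcard⟩
      refine ⟨G'.verts.toFinset, ⟨by simpa using hclique, by simpa using hcard⟩, ?_⟩
      simpa using hind.symm
    · rintro ⟨t, ht, rfl⟩
      exact ⟨⟨ht.isClique, rfl⟩, by simpa using ht.card_eq⟩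
  rw [SimpleGraph.copyCount, ← Set.ncard_coe_finset, coe_filter_univ, himage]
  refine Set.ncard_image_of_injective _ fun t u h => ?_
  exact coe_injective (congrArg SimpleGraph.Subgraph.verts h)

lemma ncard_cliqueSet_le_of_isContained [Finite W] {G : SimpleGraph V} {H : SimpleGraph W}
    (h : G.IsContained H) (k : ℕ) : (G.cliqueSet k).ncard ≤ (H.cliqueSet k).ncard := by
  obtain ⟨f⟩ := h
  refine Set.ncard_le_ncard_of_injOn (Finset.map f.toEmbedding) (fun t ht => ?_)
    (map_injective _).injOn
  refine SimpleGraph.IsNClique.mono ?_ ht.map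
  rw [SimpleGraph.map_le_iff_le_comap]
  exact fun _ _ h => f.toHom.map_adj h

lemma ncard_cliqueSet_le_two_pow [Finite V] (G : SimpleGraph V) (k : ℕ) :
    (G.cliqueSet k).ncard ≤ 2 ^ Nat.card V := by
  have := Fintype.ofFinite V
  simpa using Set.ncard_le_card (G.cliqueSet k)

lemma exists_mem_cliqueSet_induce_map_eq {G : SimpleGraph V} {k : ℕ} {t : Finset V} {B : Set V}
    (ht : G.IsNClique k t) (htB : ↑t ⊆ B) :
    ∃ u ∈ (G.induce B).cliqueSet k, u.map (.subtype (· ∈ B)) = t := by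
  classical
  have hmap : (t.subtype (· ∈ B)).map (.subtype _) = t := subtype_map_of_mem fun x hx => htB hx
  refine ⟨t.subtype (· ∈ B), (SimpleGraph.isNClique_induce_iff ..).2 ?_, hmap⟩
  rwa [hmap]

lemma ncard_biUnion_le_mul {ι α : Type*} {S : Set ι} (hS : S.Finite) {f : ι → Set α} {c : ℕ}
    (h : ∀ i ∈ S, (f i).ncard ≤ c) : (⋃ i ∈ S, f i).ncard ≤ S.ncard * c := by
  lift S to Finset ι using hS
  rw [Set.ncard_coe_finset]
  exact (S.set_ncard_biUnion_le f).trans (sum_le_card_nsmul S _ c h)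

/-- A clique not contained in `B` is a vertex `v ∉ B` together with a clique of its
neighbourhood. -/
lemma ncard_cliqueSet_succ_le [Finite V] (G : SimpleGraph V) (B : Set V) {k e : ℕ}
    (h : ∀ v ∉ B, ((G.induce (G.neighborSet v)).cliqueSet k).ncard ≤ e) :
    (G.cliqueSet (k + 1)).ncard ≤ ((G.induce B).cliqueSet (k + 1)).ncard + Bᶜ.ncard * e := by
  classical
  let inside : Set (Finset V) := Finset.map (.subtype (· ∈ B)) '' (G.induce B).cliqueSet (k + 1)
  let through (v : V) : Set (Finset V) :=
    (fun u => insert v (u.map (.subtype _))) '' (G.induce (G.neighborSet v)).cliqueSet k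
  have hsub : G.cliqueSet (k + 1) ⊆ inside ∪ ⋃ v ∈ Bᶜ, through v := by
    intro t ht
    by_cases htB : ↑t ⊆ B
    · exact .inl (exists_mem_cliqueSet_induce_map_eq ht htB)
    · obtain ⟨v, hv, hvB⟩ := Set.not_subset.1 htB
      have hnbr : ↑(t.erase v) ⊆ G.neighborSet v := fun w hw =>
        ht.isClique hv (mem_of_mem_erase hw) (ne_of_mem_erase hw).symm
      obtain ⟨u, hu, hut⟩ := exists_mem_cliqueSet_induce_map_eq (ht.erase_of_mem hv) hnbr
      exact .inr (Set.mem_biUnion hvB ⟨u, hu, (congrArg (insert v) hut).trans (insert_erase hv)⟩)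
  have hthrough : (⋃ v ∈ Bᶜ, through v).ncard ≤ Bᶜ.ncard * e :=
    ncard_biUnion_le_mul (Set.toFinite _) fun v hv =>
      (Set.ncard_image_le (Set.toFinite _)).trans (h v hv)
  exact (Set.ncard_le_ncard hsub).trans <| (Set.ncard_union_le _ _).trans <|
    Nat.add_le_add (Set.ncard_image_le (Set.toFinite _)) hthrough

end Cliques

section Extremal

variable {V W : Type*}

lemma FamilyFree.of_isContained {𝓕 : Set FinGraph} {G : SimpleGraph V} {H : SimpleGraph W}
    (hG : FamilyFree 𝓕 G) (h : H.IsContained G) : FamilyFree 𝓕 H :=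
  fun A hA hAH => hG A hA (hAH.trans h)

lemma exists_iso_fin [Finite V] (G : SimpleGraph V) {n : ℕ} (h : Nat.card V = n) :
    ∃ H : SimpleGraph (Fin n), Nonempty (H ≃g G) := by
  have := Fintype.ofFinite V
  exact ⟨_, ⟨(G.overFinIso (Fintype.card_eq_nat_card.trans h)).symm⟩⟩

lemma bddAbove_copyCount (n : ℕ) (H : SimpleGraph W) (𝓕 : Set FinGraph) :
    BddAbove {k : ℕ | ∃ G : SimpleGraph (Fin n), FamilyFree 𝓕 G ∧ k = G.copyCount H} := by
  refine ((Set.finite_range fun G : SimpleGraph (Fin n) => G.copyCount H).subset ?_).bddAbove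
  rintro _ ⟨G, -, rfl⟩
  exact ⟨G, rfl⟩

lemma copyCount_le_ex {n : ℕ} (H : SimpleGraph W) {𝓕 : Set FinGraph} {G : SimpleGraph (Fin n)}
    (hG : FamilyFree 𝓕 G) : G.copyCount H ≤ ex n H 𝓕 :=
  le_csSup (bddAbove_copyCount n H 𝓕) ⟨G, hG, rfl⟩

lemma ex_le {n c : ℕ} {H : SimpleGraph W} {𝓕 : Set FinGraph}
    (h : ∀ G : SimpleGraph (Fin n), FamilyFree 𝓕 G → G.copyCount H ≤ c) : ex n H 𝓕 ≤ c :=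
  csSup_le' (by rintro _ ⟨G, hG, rfl⟩; exact h G hG)

lemma ncard_cliqueSet_le_ex [Finite V] {𝓕 : Set FinGraph} {G : SimpleGraph V}
    (hG : FamilyFree 𝓕 G) (k : ℕ) : (G.cliqueSet k).ncard ≤ ex (Nat.card V) (K k) 𝓕 := by
  obtain ⟨H, ⟨e⟩⟩ := exists_iso_fin G rfl
  calc (G.cliqueSet k).ncard ≤ (H.cliqueSet k).ncard :=
        ncard_cliqueSet_le_of_isContained e.isContained' k
    _ = H.copyCount (K k) := (copyCount_K H k).symm
    _ ≤ ex (Nat.card V) (K k) 𝓕 := copyCount_le_ex _ (hG.of_isContained e.isContained)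

lemma EX_nonempty [Finite V] (H : SimpleGraph W) {𝓕 : Set FinGraph} {G : SimpleGraph V}
    (hG : FamilyFree 𝓕 G) : (EX (Nat.card V) H 𝓕).Nonempty := by
  obtain ⟨G₀, ⟨e⟩⟩ := exists_iso_fin G rfl
  have hne : {k | ∃ G : SimpleGraph (Fin (Nat.card V)),
      FamilyFree 𝓕 G ∧ k = G.copyCount H}.Nonempty := ⟨_, G₀, hG.of_isContained e.isContained, rfl⟩
  obtain ⟨G', hG', h⟩ := Nat.sSup_mem hne (bddAbove_copyCount (Nat.card V) H 𝓕)
  exact ⟨G', hG', h.symm⟩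

lemma familyFree_isoClass_iff [Finite W] {H : SimpleGraph W} {G : SimpleGraph V} :
    FamilyFree (isoClass H) G ↔ H.Free G := by
  refine ⟨fun h hH => ?_, fun h A ⟨e⟩ hA => h (e.isContained'.trans hA)⟩
  obtain ⟨A, ⟨e⟩⟩ := exists_iso_fin H rfl
  exact h ⟨_, A⟩ ⟨e⟩ (e.isContained.trans hH)

lemma familyFree_forbiddenPair_iff [Finite W] {F : SimpleGraph W} {s : ℕ} {G : SimpleGraph V} :
    FamilyFree (forbiddenPair F s) G ↔ F.Free G ∧ (M (s + 1)).Free G := by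
  rw [← familyFree_isoClass_iff, ← familyFree_isoClass_iff (H := M (s + 1))]
  simp only [FamilyFree, forbiddenPair, Set.mem_union, or_imp, forall_and]

lemma familyFree_deletionFamily_iff [Finite W] {F : SimpleGraph W} {G : SimpleGraph V} :
    FamilyFree (deletionFamily F) G ↔ ∀ S, F.IsIndepSet S → (F.induce Sᶜ).Free G := by
  simp_rw [← familyFree_isoClass_iff]
  exact ⟨fun h S hS A hA => h A ⟨S, hS, hA⟩, fun h A ⟨S, hS, hA⟩ => h S hS A hA⟩

end Extremal

section Matching

variable {V : Type*} {G : SimpleGraph V}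

lemma isContained_induce {W : Type*} {A : SimpleGraph W} {B : Set V} (f : SimpleGraph.Copy A G)
    (hB : ∀ a, f a ∈ B) : A.IsContained (G.induce B) :=
  ⟨⟨⟨fun a => ⟨f a, hB a⟩, f.toHom.map_adj⟩,
    fun _ _ h => f.injective (congrArg Subtype.val h)⟩⟩

lemma M_adj_false_true {k : ℕ} (i : Fin k) : (M k).Adj (i, false) (i, true) :=
  ⟨rfl, Bool.false_ne_true⟩

lemma M_succ_isContained_induce {k : ℕ} {X Y : Set V} {u v : V} (h : (M k).IsContained (G.induce X))
    (hXY : X ⊆ Y) (huv : G.Adj u v) (hu : u ∈ Y \ X) (hv : v ∈ Y \ X) :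
    (M (k + 1)).IsContained (G.induce Y) := by
  obtain ⟨f⟩ := h
  let g : Fin (k + 1) → Bool → Y :=
    Fin.cons (fun b => bif b then ⟨v, hv.1⟩ else ⟨u, hu.1⟩) fun i b => ⟨f (i, b), hXY (f (i, b)).2⟩
  have hadj (i : Fin (k + 1)) : G.Adj (g i false) (g i true) := by
    cases i using Fin.cases with
    | zero => exact huv
    | succ i => exact f.toHom.map_adj (M_adj_false_true i)
  have hnew (i : Fin k) (a b : Bool) : g 0 a ≠ g i.succ b := fun h => by
    have hmem : (g 0 a : V) ∈ X := h ▸ (f (i, b)).2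
    cases a
    exacts [hu.2 hmem, hv.2 hmem]
  refine ⟨⟨⟨fun x => g x.1 x.2, ?_⟩, ?_⟩⟩
  · rintro ⟨i, a⟩ ⟨_, b⟩ ⟨rfl, hab⟩
    cases a <;> cases b
    exacts [absurd rfl hab, hadj i, (hadj i).symm, absurd rfl hab]
  · rintro ⟨i, a⟩ ⟨j, b⟩ (hij : g i a = g j b)
    induction i using Fin.cases with
    | zero =>
      induction j using Fin.cases with
      | zero =>
        cases a <;> cases b
        exacts [rfl, absurd (congrArg Subtype.val hij) huv.ne,
          absurd (congrArg Subtype.val hij) huv.ne', rfl]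
      | succ j => exact absurd hij (hnew j a b)
    | succ i =>
      induction j using Fin.cases with
      | zero => exact absurd hij.symm (hnew i b a)
      | succ j =>
        have hf : f (i, a) = f (j, b) := Subtype.ext (congrArg Subtype.val hij :)
        simpa using f.injective hf

lemma M_isContained_induce [Finite V] {A : Finset V} {X : Set V} (hAX : Disjoint ↑A X)
    (hA : ∀ a ∈ A, 2 * #A + X.ncard ≤ (G.neighborSet a).ncard) :
    (M #A).IsContained (G.induce Xᶜ) := by
  classical
  induction A using Finset.induction generalizing X with
  | empty =>
    rw [card_empty]
    exact .of_isEmpty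
  | insert a A ha ih =>
    rw [card_insert_of_notMem ha] at hA ⊢
    rw [coe_insert, Set.disjoint_insert_left] at hAX
    obtain ⟨b, hb, hbAX⟩ : ∃ b ∈ G.neighborSet a, b ∉ ↑(insert a A) ∪ X := by
      refine Set.exists_mem_notMem_of_ncard_lt_ncard ((Set.ncard_union_le _ _).trans_lt ?_)
      rw [Set.ncard_coe_finset, card_insert_of_notMem ha]
      have := hA a (mem_insert_self a A)
      lia
    simp only [coe_insert, Set.mem_union, Set.mem_insert_iff, mem_coe, not_or] at hbAX
    have hX : (insert a (insert b X)).ncard ≤ X.ncard + 2 :=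
      (Set.ncard_insert_le _ _).trans (Nat.succ_le_succ (Set.ncard_insert_le _ _))
    refine M_succ_isContained_induce (ih (X := insert a (insert b X)) ?_ fun c hc => ?_) ?_ hb ?_ ?_
    · simp [Set.disjoint_insert_right, ha, hbAX, hAX]
    · have := hA c (mem_insert_of_mem hc)
      lia
    · exact Set.compl_subset_compl.2 fun x hx => .inr (.inr hx)
    · simp [hAX]
    · simp [hbAX]

lemma le_ncard_of_isVertexCover [Finite V] {k : ℕ} {U : Set V} (hU : G.IsVertexCover U)
    (h : (M k).IsContained G) : k ≤ U.ncard := by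
  obtain ⟨f⟩ := h
  have hmem (i : Fin k) : ∃ b, f (i, b) ∈ U :=
    (hU (f.toHom.map_adj (M_adj_false_true i))).elim (⟨_, ·⟩) (⟨_, ·⟩)
  choose b hb using hmem
  have hinj : Function.Injective fun i => (⟨f (i, b i), hb i⟩ : U) := fun i j hij =>
    congrArg Prod.fst (f.injective (congrArg Subtype.val hij))
  simpa using Nat.card_le_card_of_injective _ hinj

lemma exists_isVertexCover_of_free {s : ℕ} (h : (M (s + 1)).Free G) :
    ∃ U : Set V, U.ncard ≤ 2 * s ∧ G.IsVertexCover U := by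
  obtain ⟨k, hk, ⟨f⟩, hmax⟩ :
      ∃ k ≤ s, (M k).IsContained G ∧ (M (k + 1)).Free G := by
    by_contra! hsucc
    have hall : ∀ k ≤ s + 1, (M k).IsContained G := by
      intro k
      induction k with
      | zero => exact fun _ => .of_isEmpty
      | succ k ih => exact fun hk => hsucc k (by lia) (ih (by lia))
    exact h (hall _ le_rfl)
  refine ⟨Set.range f, ?_, fun u v huv => ?_⟩
  · calc (Set.range f).ncard ≤ Nat.card (Fin k × Bool) := by
          rw [← Set.image_univ, ← Set.ncard_univ]; exact Set.ncard_image_le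
      _ ≤ 2 * s := by simp; lia
  · by_contra! huv'
    have hf := isContained_induce f Set.mem_range_self
    exact hmax ((M_succ_isContained_induce hf (Set.subset_univ _) huv ⟨trivial, huv'.1⟩
      ⟨trivial, huv'.2⟩).trans G.induceUnivIso.isContained)

/-- The vertices of degree at least `d`. The threshold used below is `2 * s + 2`: any
`s + 1` vertices of that degree can be matched greedily to new neighbours, and any `s` of them even
while avoiding the two ends of a given edge. -/
def highDegree (G : SimpleGraph V) (d : ℕ) : Set V :=
  {v | d ≤ (G.neighborSet v).ncard}

lemma ncard_highDegree_le [Finite V] {s : ℕ} (h : (M (s + 1)).Free G) :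
    (highDegree G (2 * s + 2)).ncard ≤ s := by
  by_contra! hcard
  obtain ⟨B, hB, hBs⟩ := Set.exists_subset_card_eq (Nat.succ_le_of_lt hcard)
  lift B to Finset V using B.toFinite
  rw [Set.ncard_coe_finset, Nat.succ_eq_add_one] at hBs
  have hM : (M #B).IsContained (G.induce ∅ᶜ) := by
    refine M_isContained_induce (Set.disjoint_empty _) fun b hb => ?_
    have hdeg : 2 * s + 2 ≤ (G.neighborSet b).ncard := hB hb
    rw [Set.ncard_empty]
    lia
  rw [hBs] at hM
  exact h (hM.trans ⟨SimpleGraph.Copy.induce G _⟩)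

lemma isVertexCover_highDegree [Finite V] {s : ℕ} (h : (M (s + 1)).Free G)
    (hs : (highDegree G (2 * s + 2)).ncard = s) : G.IsVertexCover (highDegree G (2 * s + 2)) := by
  intro u v huv
  by_contra! huvA
  obtain ⟨A, hA⟩ := (highDegree G (2 * s + 2)).toFinite.exists_finset_coe
  rw [← hA, Set.ncard_coe_finset] at hs
  have hM : (M #A).IsContained (G.induce {u, v}ᶜ) := by
    refine M_isContained_induce ?_ fun a ha => ?_
    · rw [hA]
      simpa [Set.disjoint_insert_right] using huvA
    · have hmem : a ∈ highDegree G (2 * s + 2) := hA ▸ ha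
      have hdeg : 2 * s + 2 ≤ (G.neighborSet a).ncard := hmem
      rw [Set.ncard_pair huv.ne]
      lia
  have hM' := M_succ_isContained_induce hM (Set.subset_univ _) huv (by simp) (by simp)
  rw [hs] at hM'
  exact h (hM'.trans G.induceUnivIso.isContained)

end Matching

section Join

variable {V W : Type*}

lemma exists_isIndepSet_of_isContained_join_bot {U : Type*} {F : SimpleGraph U} {D : SimpleGraph V}
    (h : F.IsContained (join D (⊥ : SimpleGraph W))) :
    ∃ S, F.IsIndepSet S ∧ (F.induce Sᶜ).IsContained D := by
  obtain ⟨f⟩ := h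
  refine ⟨{u | (f u).isRight}, fun u hu v hv _ huv => ?_, ?_⟩
  · obtain ⟨x, hx⟩ := Sum.isRight_iff.1 hu
    obtain ⟨y, hy⟩ := Sum.isRight_iff.1 hv
    have hadj : (join D ⊥).Adj (f u) (f v) := f.toHom.map_adj huv
    rw [hx, hy] at hadj
    exact hadj
  · have hleft (u : ↥{u | (f u).isRight}ᶜ) : ∃ v, f u = Sum.inl v :=
      Sum.isLeft_iff.1 (Sum.not_isRight.1 u.2)
    choose g hg using hleft
    refine ⟨⟨⟨g, fun {u v} huv => ?_⟩, fun u v huv => ?_⟩⟩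
    · have hadj : (join D ⊥).Adj (f u) (f v) := f.toHom.map_adj huv
      rw [hg, hg] at hadj
      exact hadj
    · have hf : f u = f v := by
        rw [hg, hg]
        exact congrArg Sum.inl huv
      exact Subtype.ext (f.injective hf)

lemma isVertexCover_join_bot (D : SimpleGraph V) :
    (join D (⊥ : SimpleGraph W)).IsVertexCover (Set.range Sum.inl) := by
  rintro (v | w) (v' | w') h
  · exact .inl ⟨v, rfl⟩
  · exact .inl ⟨v, rfl⟩
  · exact .inr ⟨v', rfl⟩
  · exact h.elim

lemma isNClique_join_disjSum {G : SimpleGraph V} {H : SimpleGraph W} {t : Finset V} {u : Finset W}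
    {k l : ℕ} (ht : G.IsNClique k t) (hu : H.IsNClique l u) :
    (join G H).IsNClique (k + l) (t.disjSum u) := by
  refine ⟨?_, by rw [card_disjSum, ht.card_eq, hu.card_eq]⟩
  rintro (v | w) hx (v' | w') hy hne
  · exact ht.isClique (inl_mem_disjSum.1 hx) (inl_mem_disjSum.1 hy) (ne_of_apply_ne _ hne)
  · trivial
  · trivial
  · exact hu.isClique (inr_mem_disjSum.1 hx) (inr_mem_disjSum.1 hy) (ne_of_apply_ne _ hne)

lemma ncard_cliqueSet_add_le_join [Finite V] [Finite W] (G : SimpleGraph V) (H : SimpleGraph W)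
    (k : ℕ) : (G.cliqueSet (k + 1)).ncard + Nat.card W * (G.cliqueSet k).ncard ≤
      ((join G H).cliqueSet (k + 1)).ncard := by
  let inside : Set (Finset V × Finset W) := G.cliqueSet (k + 1) ×ˢ {∅}
  let mixed : Set (Finset V × Finset W) := G.cliqueSet k ×ˢ Set.range singleton
  have hdisj : Disjoint inside mixed := by
    refine Set.disjoint_prod.2 (.inr ?_)
    simp
  have hcard : (inside ∪ mixed).ncard =
      (G.cliqueSet (k + 1)).ncard + Nat.card W * (G.cliqueSet k).ncard := by
    rw [Set.ncard_union_eq hdisj, Set.ncard_prod, Set.ncard_prod, Set.ncard_singleton, mul_one,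
      ← Set.image_univ, Set.ncard_image_of_injective _ singleton_injective, Set.ncard_univ,
      mul_comm]
  rw [← hcard]
  refine Set.ncard_le_ncard_of_injOn (Function.uncurry disjSum) ?_
    (Function.Injective2.uncurry Injective2_disjSum).injOn
  rintro ⟨t, _⟩ (⟨ht, rfl⟩ | ⟨ht, ⟨w, rfl⟩⟩)
  · exact isNClique_join_disjSum (l := 0) ht (SimpleGraph.isNClique_empty.2 rfl)
  · exact isNClique_join_disjSum ht (SimpleGraph.isNClique_singleton.2 rfl)

end Join

section Turan

variable {V W : Type*}

lemma colorable_succ_of_induce_compl {F : SimpleGraph V} {S : Set V} (hS : F.IsIndepSet S) {k : ℕ}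
    (h : (F.induce Sᶜ).Colorable k) : F.Colorable (k + 1) := by
  classical
  obtain ⟨c⟩ := h
  refine ⟨SimpleGraph.Coloring.mk
    (fun v => if hv : v ∈ S then Fin.last k else (c ⟨v, hv⟩).castSucc) ?_⟩
  intro v w hvw
  by_cases hv : v ∈ S <;> by_cases hw : w ∈ S <;> simp only [hv, hw, dite_true, dite_false]
  · exact absurd hvw (hS hv hw hvw.ne)
  · exact (Fin.castSucc_lt_last _).ne'
  · exact (Fin.castSucc_lt_last _).ne
  · exact fun h => c.valid (v := ⟨v, hv⟩) (w := ⟨w, hw⟩) hvw (Fin.castSucc_injective _ h)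

lemma familyFree_deletionFamily_of_colorable {F : SimpleGraph V} {G : SimpleGraph W} {k : ℕ}
    (hF : (k + 1 : ℕ) < F.chromaticNumber) (hG : G.Colorable k) :
    FamilyFree (deletionFamily F) G := by
  rintro A ⟨S, hS, ⟨e⟩⟩ ⟨f⟩
  have hcol : (F.induce Sᶜ).Colorable k := (hG.of_hom f.toHom).of_hom e.symm.toHom
  exact hF.not_ge (colorable_succ_of_induce_compl hS hcol).chromaticNumber_le

lemma turanGraph_colorable (m : ℕ) {k : ℕ} (hk : 0 < k) :
    (SimpleGraph.turanGraph m k).Colorable k :=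
  ⟨SimpleGraph.Coloring.mk (fun v => ⟨v % k, Nat.mod_lt _ hk⟩) fun h h' =>
    h (congrArg Fin.val h')⟩

lemma pow_le_ncard_cliqueSet_completeEquipartiteGraph (k t : ℕ) :
    t ^ k ≤ ((SimpleGraph.completeEquipartiteGraph k t).cliqueSet k).ncard := by
  let transversal (f : Fin k → Fin t) : Finset (Fin k × Fin t) :=
    univ.map ⟨fun i => (i, f i), fun _ _ h => congrArg Prod.fst h⟩
  have hclique (f : Fin k → Fin t) :
      (SimpleGraph.completeEquipartiteGraph k t).IsNClique k (transversal f) := by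
    refine ⟨fun x hx y hy hxy => ?_, by simp [transversal]⟩
    obtain ⟨i, -, rfl⟩ := mem_map.1 hx
    obtain ⟨j, -, rfl⟩ := mem_map.1 hy
    rintro (rfl : i = j)
    exact hxy rfl
  have hinj : Function.Injective transversal := fun f g hfg => funext fun i => by
    have hi : (i, f i) ∈ transversal g := hfg ▸ mem_map_of_mem _ (mem_univ i)
    obtain ⟨j, -, hj⟩ := mem_map.1 hi
    obtain ⟨rfl, hij⟩ := Prod.ext_iff.1 hj
    exact hij.symm
  calc t ^ k = (Set.univ : Set (Fin k → Fin t)).ncard := by simp [Set.ncard_univ]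
    _ ≤ _ := Set.ncard_le_ncard_of_injOn transversal (fun f _ => hclique f) hinj.injOn

lemma pow_le_ncard_cliqueSet_turanGraph (m k : ℕ) :
    (m / k) ^ k ≤ ((SimpleGraph.turanGraph m k).cliqueSet k).ncard := by
  have hcast : (SimpleGraph.turanGraph (k * (m / k)) k).IsContained (SimpleGraph.turanGraph m k) :=
    ⟨⟨⟨Fin.castLE (Nat.mul_div_le m k), fun h => h⟩, Fin.castLE_injective (Nat.mul_div_le m k)⟩⟩
  exact (pow_le_ncard_cliqueSet_completeEquipartiteGraph k (m / k)).trans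
    (ncard_cliqueSet_le_of_isContained
      (SimpleGraph.completeEquipartiteGraph.turanGraph.isContained.trans hcast) k)

lemma EX_deletionFamily_nonempty {F : SimpleGraph V} {k : ℕ} (hk : 0 < k)
    (hF : (k + 1 : ℕ) < F.chromaticNumber) (H : SimpleGraph W) (m : ℕ) :
    (EX m H (deletionFamily F)).Nonempty := by
  have hfree := familyFree_deletionFamily_of_colorable hF (turanGraph_colorable m hk)
  exact Nat.card_fin m ▸ EX_nonempty H hfree

lemma pow_le_ex_deletionFamily {F : SimpleGraph V} {k : ℕ} (hk : 0 < k)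
    (hF : (k + 1 : ℕ) < F.chromaticNumber) (m : ℕ) :
    (m / k) ^ k ≤ ex m (K k) (deletionFamily F) := by
  have hfree := familyFree_deletionFamily_of_colorable hF (turanGraph_colorable m hk)
  simpa using (pow_le_ncard_cliqueSet_turanGraph m k).trans (ncard_cliqueSet_le_ex hfree k)

end Turan

section Growth

variable {V : Type*} {G : SimpleGraph V}

/-- The common neighbourhood of a set `B` of vertices. -/
def commonNbrs (G : SimpleGraph V) (B : Set V) : Set V :=
  {v | ∀ b ∈ B, G.Adj v b}

/-- The graph `G` together with a new vertex `none` whose neighbourhood is `Q`, used to increase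
the number of cliques. -/
def addVertex (G : SimpleGraph V) (Q : Set V) : SimpleGraph (Option V) where
  Adj x y :=
    match x, y with
    | some v, some w => G.Adj v w
    | none, some w => w ∈ Q
    | some v, none => v ∈ Q
    | none, none => False
  symm := ⟨by
    rintro (_ | v) (_ | w) h
    · exact h
    · exact h
    · exact h
    · exact G.adj_symm h⟩
  loopless := ⟨by
    rintro (_ | v) h
    · exact h
    · exact G.irrefl h⟩

lemma isContained_of_isContained_addVertex {W : Type*} [Finite W] {A : SimpleGraph W} {Q : Set V}
    (h : A.IsContained (addVertex G Q)) (hQ : Nat.card W < (commonNbrs G Q).ncard) :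
    A.IsContained G := by
  obtain ⟨φ⟩ := h
  -- A common neighbour of `Q` outside the copy can replace the new vertex.
  obtain ⟨_, ⟨t, htQ, rfl⟩, htφ⟩ : ∃ x ∈ some '' commonNbrs G Q, x ∉ Set.range φ := by
    refine Set.exists_mem_notMem_of_ncard_lt_ncard ?_
    rw [Set.ncard_image_of_injective _ (Option.some_injective V)]
    calc (Set.range φ).ncard ≤ (Set.univ : Set W).ncard := by
          rw [← Set.image_univ]; exact Set.ncard_image_le
      _ < (commonNbrs G Q).ncard := by rwa [Set.ncard_univ]
  have hadj {x y : Option V} (hxy : (addVertex G Q).Adj x y) : G.Adj (x.getD t) (y.getD t) := by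
    cases x <;> cases y
    exacts [hxy.elim, htQ _ hxy, (htQ _ hxy).symm, hxy]
  have hinj {x y : Option V} (hx : x ≠ some t) (hy : y ≠ some t) (hxy : x.getD t = y.getD t) :
      x = y := by
    cases x <;> cases y <;> simp_all
  exact ⟨⟨⟨fun a => (φ a).getD t, fun hab => hadj (φ.toHom.map_adj hab)⟩, fun a b hab =>
    φ.injective (hinj (fun h => htφ ⟨a, h⟩) (fun h => htφ ⟨b, h⟩) hab)⟩⟩

lemma ncard_cliqueSet_lt_addVertex [Finite V] {k : ℕ} {Q : Finset V} (hQ : G.IsNClique k Q) :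
    (G.cliqueSet (k + 1)).ncard < ((addVertex G Q).cliqueSet (k + 1)).ncard := by
  classical
  have hadd {j : ℕ} {t : Finset V} (ht : G.IsNClique j t) :
      (addVertex G Q).IsNClique j (t.map .some) := by
    refine ht.map.mono ?_
    rw [SimpleGraph.map_le_iff_le_comap]
    exact fun _ _ h => h
  have hnew : insert none (Q.map .some) ∈ (addVertex G Q).cliqueSet (k + 1) := by
    refine (hadd hQ).insert fun x hx => ?_
    obtain ⟨v, hv, rfl⟩ := mem_map.1 hx
    exact hv
  rw [← Set.ncard_image_of_injective _ (map_injective Function.Embedding.some)]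
  refine Set.ncard_lt_ncard ((Set.ssubset_iff_of_subset ?_).2 ⟨_, hnew, ?_⟩)
  · rintro _ ⟨t, ht, rfl⟩
    exact hadd ht
  · rintro ⟨t, -, ht⟩
    have hnone : none ∈ t.map .some := ht ▸ mem_insert_self none _
    simp at hnone

lemma ncard_cliqueSet_le_pow [Finite V] (G : SimpleGraph V) (k : ℕ) :
    (G.cliqueSet k).ncard ≤ Nat.card V ^ k := by
  have := Fintype.ofFinite V
  have hsub : G.cliqueSet k ⊆ (univ : Finset V).powersetCard k := fun t ht =>
    mem_coe.2 (mem_powersetCard.2 ⟨subset_univ _, ht.card_eq⟩)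
  refine (Set.ncard_le_ncard hsub).trans ?_
  rw [Set.ncard_coe_finset, card_powersetCard, card_univ, Fintype.card_eq_nat_card]
  exact Nat.choose_le_pow _ _

lemma exists_isNClique_lt_ncard_commonNbrs [Finite V] {k f : ℕ}
    (h : f * Nat.card V ^ k < (G.cliqueSet (k + 1)).ncard) :
    ∃ Q : Finset V, G.IsNClique k Q ∧ f < (commonNbrs G Q).ncard := by
  classical
  by_contra! hf
  have hsub : G.cliqueSet (k + 1) ⊆ ⋃ Q ∈ G.cliqueSet k, (insert · Q) '' commonNbrs G Q := by
    intro t ht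
    obtain ⟨v, hv⟩ : t.Nonempty := card_pos.1 (by rw [ht.card_eq]; lia)
    refine Set.mem_biUnion (ht.erase_of_mem hv) ⟨v, fun w hw => ?_, insert_erase hv⟩
    exact ht.isClique hv (mem_of_mem_erase hw) (ne_of_mem_erase hw).symm
  refine h.not_ge ?_
  calc (G.cliqueSet (k + 1)).ncard
      ≤ (⋃ Q ∈ G.cliqueSet k, (insert · Q) '' commonNbrs G Q).ncard := Set.ncard_le_ncard hsub
    _ ≤ (G.cliqueSet k).ncard * f := ncard_biUnion_le_mul (Set.toFinite _) fun Q hQ =>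
        (Set.ncard_image_le (Set.toFinite _)).trans (hf Q hQ)
    _ ≤ f * Nat.card V ^ k := by
        rw [mul_comm]
        exact Nat.mul_le_mul_left f (ncard_cliqueSet_le_pow G k)

lemma mul_pow_lt_div_pow (f k : ℕ) {m : ℕ} (hm : (k + 1) * (f * (2 * (k + 1)) ^ k + 1) ≤ m) :
    f * m ^ k < (m / (k + 1)) ^ (k + 1) := by
  have hq : f * (2 * (k + 1)) ^ k + 1 ≤ m / (k + 1) := by
    rwa [Nat.le_div_iff_mul_le (by lia), mul_comm]
  set q := m / (k + 1)
  have hmq : m ≤ 2 * (k + 1) * q := by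
    have hlt : m < (k + 1) * (q + 1) := Nat.lt_mul_div_succ m (by lia)
    have hle : (k + 1) * 1 ≤ (k + 1) * q := Nat.mul_le_mul_left _ (by lia)
    linarith
  calc f * m ^ k ≤ f * (2 * (k + 1) * q) ^ k := by gcongr
    _ = f * (2 * (k + 1)) ^ k * q ^ k := by rw [mul_pow, mul_assoc]
    _ < q * q ^ k := Nat.mul_lt_mul_of_pos_right (by lia) (pow_pos (by lia) _)
    _ = q ^ (k + 1) := (pow_succ' q k).symm

lemma card_le_of_mem_deletionFamily [Finite V] {F : SimpleGraph V} {A : FinGraph}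
    (hA : A ∈ deletionFamily F) : A.1 ≤ Nat.card V := by
  obtain ⟨S, -, ⟨e⟩⟩ := hA
  simpa using Nat.card_le_card_of_injective _ (Subtype.val_injective.comp e.injective)

lemma ex_deletionFamily_lt_succ [Finite V] {F : SimpleGraph V} {k m : ℕ}
    (hF : (k + 2 : ℕ) < F.chromaticNumber)
    (hm : (k + 1) * (Nat.card V * (2 * (k + 1)) ^ k + 1) ≤ m) :
    ex m (K (k + 1)) (deletionFamily F) < ex (m + 1) (K (k + 1)) (deletionFamily F) := by
  obtain ⟨G, hG, hGex⟩ := EX_deletionFamily_nonempty k.succ_pos hF (K (k + 1)) m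
  rw [← hGex, copyCount_K]
  obtain ⟨Q, hQ, hcard⟩ : ∃ Q : Finset (Fin m), G.IsNClique k Q ∧
      Nat.card V < (commonNbrs G Q).ncard := by
    refine exists_isNClique_lt_ncard_commonNbrs ?_
    rw [← copyCount_K, hGex, Nat.card_fin]
    exact (mul_pow_lt_div_pow _ k hm).trans_le (pow_le_ex_deletionFamily k.succ_pos hF m)
  have hfree : FamilyFree (deletionFamily F) (addVertex G Q) := fun A hA hAG =>
    hG A hA <| isContained_of_isContained_addVertex hAG <| by
      simpa using (card_le_of_mem_deletionFamily hA).trans_lt hcard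
  refine (ncard_cliqueSet_lt_addVertex hQ).trans_le ?_
  simpa using ncard_cliqueSet_le_ex hfree (k + 1)

lemma exists_forall_lt_of_lt_succ {e : ℕ → ℕ} {m₀ : ℕ} (h : ∀ m ≥ m₀, e m < e (m + 1)) :
    ∃ s₀, ∀ s ≥ s₀, ∀ m < s, e m < e s := by
  have hmono : StrictMono fun d => e (m₀ + d) := strictMono_nat_of_lt_succ fun d => h _ (by lia)
  refine ⟨m₀ + (range m₀).sup e + 1, fun s hs m hms => ?_⟩
  obtain ⟨d, rfl⟩ := Nat.exists_eq_add_of_le (by lia : m₀ ≤ s)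
  obtain hm | hm := lt_or_ge m m₀
  · have hsup : e m ≤ (range m₀).sup e := le_sup (mem_range.2 hm)
    have hd : d ≤ e (m₀ + d) := hmono.le_apply
    lia
  · obtain ⟨c, rfl⟩ := Nat.exists_eq_add_of_le hm
    exact hmono (by lia : c < d)

lemma exists_forall_ex_deletionFamily_lt [Finite V] {F : SimpleGraph V} {k : ℕ}
    (hF : (k + 2 : ℕ) < F.chromaticNumber) : ∃ s₀, ∀ s ≥ s₀, ∀ m < s,
      ex m (K (k + 1)) (deletionFamily F) < ex s (K (k + 1)) (deletionFamily F) :=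
  exists_forall_lt_of_lt_succ fun _ => ex_deletionFamily_lt_succ hF

end Growth

section UpperBound

variable {V W : Type*} [Finite V] {F : SimpleGraph W} {G : SimpleGraph V}

lemma familyFree_deletionFamily_induce [Finite W] (hF : F.Free G) {B : Set V}
    (hB : Nat.card W ≤ (commonNbrs G B).ncard) :
    FamilyFree (deletionFamily F) (G.induce B) := by
  classical
  have := Fintype.ofFinite V
  have := Fintype.ofFinite W
  rintro A ⟨S, hS, ⟨e⟩⟩ ⟨f⟩
  obtain ⟨g⟩ : Nonempty (W ↪ commonNbrs G B) :=
    Function.Embedding.nonempty_of_card_le (by simpa [← Nat.card_eq_fintype_card] using hB)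
  let h (w : W) : V := if hw : w ∈ S then g w else f (e.symm ⟨w, hw⟩)
  have hcross {w w' : W} (hw : w ∈ S) (hw' : w' ∉ S) : G.Adj (h w) (h w') := by
    simp only [h, hw, hw', dite_true, dite_false]
    exact (g w).2 _ (f (e.symm ⟨w', hw'⟩)).2
  refine hF ⟨⟨⟨h, fun {w w'} hww' => ?_⟩, fun w w' hww' => ?_⟩⟩
  · by_cases hw : w ∈ S <;> by_cases hw' : w' ∈ S
    · exact absurd hww' (hS hw hw' hww'.ne)
    · exact hcross hw hw'
    · exact (hcross hw' hw).symm
    · simp only [h, hw, hw', dite_false]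
      have hadj : (F.induce Sᶜ).Adj ⟨w, hw⟩ ⟨w', hw'⟩ := hww'
      exact f.toHom.map_adj (e.symm.map_adj_iff.2 hadj)
  · replace hww' : h w = h w' := hww'
    by_cases hw : w ∈ S <;> by_cases hw' : w' ∈ S
    · simp only [h, hw, hw', dite_true] at hww'
      exact g.injective (Subtype.ext hww')
    · exact absurd hww' (hcross hw hw').ne
    · exact absurd hww' (hcross hw' hw).ne'
    · simp only [h, hw, hw', dite_false] at hww'
      exact congrArg Subtype.val (e.symm.injective (f.injective (Subtype.ext hww')))

lemma ncard_neighborSet_not_subset_highDegree_le {U : Set V} (hU : G.IsVertexCover U) (d : ℕ) :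
    {v | ¬ G.neighborSet v ⊆ highDegree G d}.ncard ≤ U.ncard * (d + 1) := by
  have hsub : {v | ¬ G.neighborSet v ⊆ highDegree G d} ⊆
      U ∪ ⋃ u ∈ U \ highDegree G d, G.neighborSet u := by
    intro v hv
    obtain ⟨u, huv, hu⟩ := Set.not_subset.1 hv
    exact (hU huv).imp_right fun huU => Set.mem_biUnion ⟨huU, hu⟩ huv.symm
  have hlow : (⋃ u ∈ U \ highDegree G d, G.neighborSet u).ncard ≤ U.ncard * d :=
    (ncard_biUnion_le_mul (Set.toFinite _) fun u hu => (not_le.1 hu.2).le).trans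
      (Nat.mul_le_mul_right d (Set.ncard_le_ncard Set.sdiff_subset))
  rw [mul_add_one, add_comm]
  exact (Set.ncard_le_ncard hsub).trans ((Set.ncard_union_le _ _).trans (by lia))

/-- Vertices with the same neighbourhood `B` are common neighbours of `B`. -/
lemma ncard_neighborSet_subset_not_familyFree_le [Finite W] (hF : F.Free G) (A : Set V) :
    {v | G.neighborSet v ⊆ A ∧
      ¬ FamilyFree (deletionFamily F) (G.induce (G.neighborSet v))}.ncard ≤
        2 ^ A.ncard * Nat.card W := by
  let twins (B : Set V) : Set V :=
    {v | G.neighborSet v = B ∧ ¬ FamilyFree (deletionFamily F) (G.induce B)}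
  have hsub : {v | G.neighborSet v ⊆ A ∧
      ¬ FamilyFree (deletionFamily F) (G.induce (G.neighborSet v))} ⊆ ⋃ B ∈ 𝒫 A, twins B :=
    fun v hv => Set.mem_biUnion hv.1 ⟨rfl, hv.2⟩
  have htwins (B : Set V) : (twins B).ncard ≤ Nat.card W := by
    by_contra! hB
    obtain ⟨_, -, hnot⟩ := Set.nonempty_of_ncard_ne_zero (Nat.ne_zero_of_lt hB)
    refine hnot (familyFree_deletionFamily_induce hF (hB.le.trans (Set.ncard_le_ncard ?_)))
    rintro v ⟨rfl, -⟩ b hb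
    exact hb
  rw [← Set.ncard_powerset]
  exact (Set.ncard_le_ncard hsub).trans
    (ncard_biUnion_le_mul (Set.toFinite _) fun B _ => htwins B)

/-- The vertices having a neighbour of degree less than `d`, or a neighbourhood that does not
induce a `𝓓(F)`-free graph. -/
def exceptional (F : SimpleGraph W) (G : SimpleGraph V) (d : ℕ) : Set V :=
  {v | ¬ (G.neighborSet v ⊆ highDegree G d ∧
    FamilyFree (deletionFamily F) (G.induce (G.neighborSet v)))}

lemma ncard_exceptional_le [Finite W] {s : ℕ} (hF : F.Free G) (hM : (M (s + 1)).Free G) :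
    (exceptional F G (2 * s + 2)).ncard ≤ 2 * s * (2 * s + 3) + 2 ^ s * Nat.card W := by
  obtain ⟨U, hUs, hU⟩ := exists_isVertexCover_of_free hM
  set A := highDegree G (2 * s + 2)
  have hsub : exceptional F G (2 * s + 2) ⊆ {v | ¬ G.neighborSet v ⊆ A} ∪
      {v | G.neighborSet v ⊆ A ∧ ¬ FamilyFree (deletionFamily F) (G.induce (G.neighborSet v))} :=
    fun v hv => (em (G.neighborSet v ⊆ A)).symm.imp_right fun h => ⟨h, fun h' => hv ⟨h, h'⟩⟩
  calc _ ≤ _ := Set.ncard_le_ncard hsub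
    _ ≤ _ := Set.ncard_union_le _ _
    _ ≤ U.ncard * (2 * s + 2 + 1) + 2 ^ A.ncard * Nat.card W :=
        Nat.add_le_add (ncard_neighborSet_not_subset_highDegree_le hU _)
          (ncard_neighborSet_subset_not_familyFree_le hF A)
    _ ≤ 2 * s * (2 * s + 3) + 2 ^ s * Nat.card W := by
        gcongr
        · exact one_le_two
        · exact ncard_highDegree_le hM

lemma ncard_cliqueSet_le_sub_mul {X : Set V} {c s k e : ℕ} (hX : X.ncard ≤ c) (he : 0 < e)
    (h : ∀ v ∉ X, ((G.induce (G.neighborSet v)).cliqueSet k).ncard < e)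
    (hV : 2 ^ c + s * e ≤ Nat.card V) : (G.cliqueSet (k + 1)).ncard ≤ (Nat.card V - s) * e := by
  obtain ⟨e, rfl⟩ := Nat.exists_eq_add_one.2 he
  calc (G.cliqueSet (k + 1)).ncard
      ≤ ((G.induce X).cliqueSet (k + 1)).ncard + Xᶜ.ncard * e :=
        ncard_cliqueSet_succ_le G X fun v hv => Nat.le_of_lt_succ (h v hv)
    _ ≤ 2 ^ c + Nat.card V * e := by
        gcongr
        · exact (ncard_cliqueSet_le_two_pow _ _).trans (Nat.pow_le_pow_right two_pos hX)
        · exact Set.ncard_le_card _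
    _ ≤ (Nat.card V - s) * (e + 1) := by
        rw [Nat.sub_mul, mul_add_one (Nat.card V)]
        lia

lemma ncard_cliqueSet_succ_le_of_isVertexCover {A : Set V} (hA : G.IsVertexCover A) (k : ℕ) :
    (G.cliqueSet (k + 1)).ncard ≤ ((G.induce A).cliqueSet (k + 1)).ncard +
      (Nat.card V - A.ncard) * ((G.induce A).cliqueSet k).ncard := by
  rw [← Set.ncard_compl]
  refine ncard_cliqueSet_succ_le G A fun v hv => ncard_cliqueSet_le_of_isContained ?_ k
  have hsub : G.neighborSet v ⊆ A := fun w hvw => (hA hvw).resolve_left hv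
  exact (G.induceHomOfLE hsub).isContained

lemma IsDF.ncard_cliqueSet_eq {s k : ℕ} {D : SimpleGraph (Fin s)} (hD : IsDF F s (k + 1) D) :
    (D.cliqueSet k).ncard = ex s (K k) (deletionFamily F) := by
  rw [← copyCount_K]
  exact hD.1.2

lemma IsDF.ncard_cliqueSet_succ_le {s k : ℕ} {D : SimpleGraph (Fin s)} (hD : IsDF F s (k + 1) D)
    (hV : Nat.card V = s) (hG : FamilyFree (deletionFamily F) G)
    (hk : ex s (K k) (deletionFamily F) ≤ (G.cliqueSet k).ncard) :
    (G.cliqueSet (k + 1)).ncard ≤ (D.cliqueSet (k + 1)).ncard := by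
  obtain ⟨D', ⟨i⟩⟩ := exists_iso_fin G hV
  have hD' : FamilyFree (deletionFamily F) D' := hG.of_isContained i.isContained
  have hle (j : ℕ) : (G.cliqueSet j).ncard ≤ D'.copyCount (K j) := by
    rw [copyCount_K]
    exact ncard_cliqueSet_le_of_isContained i.isContained' j
  rw [← copyCount_K D]
  exact (hle _).trans (hD.2 D' ⟨hD', (copyCount_le_ex _ hD').antisymm (hk.trans (hle k))⟩)

lemma ncard_cliqueSet_succ_le_of_isDF [Finite W] {s k : ℕ} (hs : 0 < s)
    (hlt : ∀ m < s, ex m (K k) (deletionFamily F) < ex s (K k) (deletionFamily F))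
    {D : SimpleGraph (Fin s)} (hD : IsDF F s (k + 1) D) (hF : F.Free G) (hM : (M (s + 1)).Free G)
    (hV : 2 ^ (2 * s * (2 * s + 3) + 2 ^ s * Nat.card W) + s * ex s (K k) (deletionFamily F) ≤
      Nat.card V) :
    (G.cliqueSet (k + 1)).ncard ≤
      (D.cliqueSet (k + 1)).ncard + (Nat.card V - s) * (D.cliqueSet k).ncard := by
  rw [hD.ncard_cliqueSet_eq]
  set e := ex s (K k) (deletionFamily F)
  by_cases hcase : ∀ v ∉ exceptional F G (2 * s + 2),
      ((G.induce (G.neighborSet v)).cliqueSet k).ncard < e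
  · exact le_add_left (ncard_cliqueSet_le_sub_mul (ncard_exceptional_le hF hM)
      ((Nat.zero_le _).trans_lt (hlt 0 hs)) hcase hV)
  push Not at hcase
  obtain ⟨v, hv, hve⟩ := hcase
  obtain ⟨hsub, hfree⟩ := not_not.1 hv
  have hle : (highDegree G (2 * s + 2)).ncard ≤ s := ncard_highDegree_le hM
  have hdeg : s ≤ (G.neighborSet v).ncard := by
    by_contra! hdeg
    exact (hlt _ hdeg).not_ge (hve.trans (ncard_cliqueSet_le_ex hfree k))
  have hA : G.neighborSet v = highDegree G (2 * s + 2) :=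
    Set.eq_of_subset_of_ncard_le hsub (hle.trans hdeg)
  rw [hA] at hdeg hve hfree
  have hcard := hle.antisymm hdeg
  have hcover := isVertexCover_highDegree hM hcard
  set A := highDegree G (2 * s + 2)
  have hAe : ((G.induce A).cliqueSet k).ncard ≤ e := by
    have hle := ncard_cliqueSet_le_ex hfree k
    rwa [Nat.card_coe_set_eq, hcard] at hle
  calc (G.cliqueSet (k + 1)).ncard
      ≤ ((G.induce A).cliqueSet (k + 1)).ncard +
        (Nat.card V - A.ncard) * ((G.induce A).cliqueSet k).ncard :=
        ncard_cliqueSet_succ_le_of_isVertexCover hcover k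
    _ ≤ (D.cliqueSet (k + 1)).ncard + (Nat.card V - s) * e := by
        rw [hcard]
        gcongr
        exact hD.ncard_cliqueSet_succ_le hcard hfree hve

end UpperBound

section MainTheorem

lemma familyFree_forbiddenPair_join_bot {V W U : Type*} [Finite V] [Finite W] [Finite U]
    {F : SimpleGraph U} {D : SimpleGraph V} (hD : FamilyFree (deletionFamily F) D) :
    FamilyFree (forbiddenPair F (Nat.card V)) (join D (⊥ : SimpleGraph W)) := by
  refine familyFree_forbiddenPair_iff.2 ⟨fun hF => ?_, fun hM => ?_⟩
  · obtain ⟨S, hS, hSD⟩ := exists_isIndepSet_of_isContained_join_bot hF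
    exact familyFree_deletionFamily_iff.1 hD S hS hSD
  · have hle := le_ncard_of_isVertexCover (isVertexCover_join_bot D) hM
    rw [← Set.image_univ, Set.ncard_image_of_injective _ Sum.inl_injective, Set.ncard_univ] at hle
    lia

lemma exists_isDF {V : Type*} {F : SimpleGraph V} {k : ℕ} (hk : 0 < k)
    (hF : (k + 1 : ℕ) < F.chromaticNumber) (s : ℕ) :
    ∃ D : SimpleGraph (Fin s), IsDF F s (k + 1) D := by
  obtain ⟨D, hD, hmax⟩ := Set.exists_max_image (EX s (K k) (deletionFamily F))
    (fun D => D.copyCount (K (k + 1))) (Set.toFinite _) (EX_deletionFamily_nonempty hk hF _ s)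
  exact ⟨D, hD, hmax⟩

lemma ex_forbiddenPair_eq {V : Type*} [Finite V] {F : SimpleGraph V} {s k n : ℕ} (hs : 0 < s)
    (hlt : ∀ m < s, ex m (K k) (deletionFamily F) < ex s (K k) (deletionFamily F))
    {D : SimpleGraph (Fin s)} (hD : IsDF F s (k + 1) D) (hsn : s ≤ n)
    (hn : 2 ^ (2 * s * (2 * s + 3) + 2 ^ s * Nat.card V) + s * ex s (K k) (deletionFamily F) ≤ n) :
    ex n (K (k + 1)) (forbiddenPair F s) = (join D (I (n - s))).copyCount (K (k + 1)) := by
  rw [copyCount_K]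
  refine le_antisymm (ex_le fun G hG => ?_) ?_
  · obtain ⟨hF, hM⟩ := familyFree_forbiddenPair_iff.1 hG
    rw [copyCount_K]
    have hupper := ncard_cliqueSet_succ_le_of_isDF hs hlt hD hF hM (by simpa using hn)
    have hlower := ncard_cliqueSet_add_le_join D (I (n - s)) k
    rw [Nat.card_fin] at hupper hlower
    exact hupper.trans hlower
  · have hfree : FamilyFree (forbiddenPair F s) (join D (I (n - s))) := by
      have h := familyFree_forbiddenPair_join_bot (W := Fin (n - s)) hD.1.1
      rwa [Nat.card_fin] at h
    simpa [hsn] using ncard_cliqueSet_le_ex hfree (k + 1)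

end MainTheorem

end GenTuran

theorem theorem1p5_general {V : Type*} [Finite V] (F : SimpleGraph V) (r : ℕ) (hr : 2 ≤ r)
    (hF : (r : ℕ∞) < F.chromaticNumber) :
    ∃ s₀ : ℕ, ∀ s : ℕ, s₀ ≤ s →
      (∃ D : SimpleGraph (Fin s), GenTuran.IsDF F s r D) ∧
      ∃ n₀ : ℕ, ∀ n : ℕ, n₀ ≤ n → s ≤ n →
        ∀ D : SimpleGraph (Fin s), GenTuran.IsDF F s r D →
          GenTuran.ex n (GenTuran.K r) (GenTuran.forbiddenPair F s) =
            (GenTuran.join D (GenTuran.I (n - s))).copyCount (GenTuran.K r) := by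
  obtain ⟨k, rfl⟩ := Nat.exists_eq_add_of_le' hr
  obtain ⟨s₀, hs₀⟩ := GenTuran.exists_forall_ex_deletionFamily_lt hF
  exact ⟨s₀ + 1, fun s hs => ⟨GenTuran.exists_isDF k.succ_pos hF s, _, fun n hn hsn D hD =>
    GenTuran.ex_forbiddenPair_eq (by lia) (hs₀ s (by lia)) hD hsn hn⟩⟩

theorem theorem1p5 {V : Type*} [Finite V] (F : SimpleGraph V) (r : ℕ) (hr : 3 ≤ r)
    (hF : (r : ℕ∞) < F.chromaticNumber) :
    ∃ s₀ : ℕ, ∀ s : ℕ, s₀ ≤ s →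
      (∃ D : SimpleGraph (Fin s), GenTuran.IsDF F s r D) ∧
      ∃ n₀ : ℕ, ∀ n : ℕ, n₀ ≤ n → s ≤ n →
        ∀ D : SimpleGraph (Fin s), GenTuran.IsDF F s r D →
          GenTuran.ex n (GenTuran.K r) (GenTuran.forbiddenPair F s) =
            (GenTuran.join D (GenTuran.I (n - s))).copyCount (GenTuran.K r) :=
  theorem1p5_general F r (by lia) hF
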